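/- Let $0<p<q$ be integers and let $\varepsilon>0$. For a finite ground set $\mathcal N$ of size $n$ with $q\mid n$, consider the problems $$\max\{f(S): S\subseteq\mathcal N,\ |S|=\tfrac pq n\}\qquad\text{and}\qquad \max\{f(S): S\subseteq\mathcal N,\ |S|\le\tfrac pq n\},$$ where $f\colon 2^{\mathcal N}\to\mathbb R_{\ge 0}$ is symmetric ($f(S)=f(\mathcal N\setminus S)$ for all $S$) and submodular ($f(S)+f(T)\ge f(S\cup T)+f(S\cap T)$ for all $S,T$), and is accessible only through a value oracle, which returns $f(S)$ for a queried set $S$. Then every algorithm with approximation ratio $\tfrac12+\varepsilon$ for one of these problems uses an exponential number of oracle queries. Precisely, there are $c>0$ and $n_0$, depending only on $p$, $q$ and $\varepsilon$, such that the following holds for each of the two problems and every ground set $\mathcal N$ whose size $n\ge n_0$ is divisible by $q$. Let $A$ be a (possibly randomized, adaptive, computationally unbounded) value-oracle algorithm that, for every non-negative symmetric submodular $f$ on $\mathcal N$, almost surely outputs a feasible set and whose output has expected value at least $(\tfrac12+\varepsilon)$ times the optimum. Then there is a non-negative symmetric submodular $f$ on $\mathcal N$ on which the expected number of oracle queries made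 by $A$ is at least $e^{cn}$. -/

import Mathlib

universe u v

namespace ValueOracle

/-- Non-negativity of a set function on the subsets of `V`. -/
def IsNonneg {V : Type u} (f : Finset V → ℝ) : Prop :=
  ∀ S, 0 ≤ f S

/-- A set function is symmetric if a set and its complement always have the same value. -/
def IsSymmetric {V : Type u} [Fintype V] [DecidableEq V] (f : Finset V → ℝ) : Prop :=
  ∀ S, f S = f Sᶜ

/-- Submodularity of a set function. -/
def IsSubmodular {V : Type u} [DecidableEq V] (f : Finset V → ℝ) : Prop :=
  ∀ S T, f (S ∪ T) + f (S ∩ T) ≤ f S + f T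

/-- The objectives under consideration: non-negative symmetric submodular functions. -/
structure IsObjective {V : Type u} [Fintype V] [DecidableEq V] (f : Finset V → ℝ) : Prop where
  nonneg : IsNonneg f
  symmetric : IsSymmetric f
  submodular : IsSubmodular f

/-- The two kinds of cardinality constraint, `|S| = (p/q) n` and `|S| ≤ (p/q) n`. -/
inductive Constraint where
  | exactly
  | atMost

/-- Feasibility of a set `S` for a cardinality constraint with ratio `p / q`, where `n` is the size
of the ground set `V`. -/
def Constraint.Feasible {V : Type u} [Fintype V] (p q : ℕ) : Constraint → Finset V → Prop
  | .exactly, S => (S.card : ℝ) = (p : ℝ) / (q : ℝ) * (Fintype.card V : ℝ)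
  | .atMost, S => (S.card : ℝ) ≤ (p : ℝ) / (q : ℝ) * (Fintype.card V : ℝ)

/-- A deterministic adaptive algorithm with access to a value oracle, as a decision tree: it either
stops and outputs a set, or queries the value of a set and continues in a way that depends on the
real number returned. There is no bound on the computation done between the queries. -/
inductive DetAlgorithm (V : Type u) : Type u where
  | output (S : Finset V) : DetAlgorithm V
  | query (S : Finset V) (next : ℝ → DetAlgorithm V) : DetAlgorithm V

/-- The set output when the oracle answers according to `f`. -/
def DetAlgorithm.result {V : Type u} (f : Finset V → ℝ) : DetAlgorithm V → Finset V
  | .output S => S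
  | .query S next => DetAlgorithm.result f (next (f S))

/-- The number of oracle queries made when the oracle answers according to `f`. -/
def DetAlgorithm.numQueries {V : Type u} (f : Finset V → ℝ) : DetAlgorithm V → ℕ
  | .output _ => 0
  | .query S next => DetAlgorithm.numQueries f (next (f S)) + 1

/-- A randomized algorithm with access to a value oracle: a random seed `ω` is drawn from an
arbitrary probability space, and then the deterministic algorithm `alg ω` is run. For every
oracle, the output and the number of queries are random variables. -/
structure RandAlgorithm (V : Type u) where
  Seed : Type v
  [measurableSpace : MeasurableSpace Seed]
  law : MeasureTheory.Measure Seed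
  [isProbabilityMeasure : MeasureTheory.IsProbabilityMeasure law]
  alg : Seed → DetAlgorithm V
  measurableSet_result : ∀ (f : Finset V → ℝ) (S : Finset V),
    MeasurableSet {ω | (alg ω).result f = S}
  measurableSet_numQueries : ∀ (f : Finset V → ℝ) (k : ℕ),
    MeasurableSet {ω | (alg ω).numQueries f = k}

attribute [instance] RandAlgorithm.measurableSpace RandAlgorithm.isProbabilityMeasure

/-- The expected value `𝔼[f(S)]` of the output set `S` on the input `f`. -/
noncomputable def RandAlgorithm.expectedValue {V : Type u} (A : RandAlgorithm.{u, v} V)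
    (f : Finset V → ℝ) : ℝ :=
  ∫ ω, f ((A.alg ω).result f) ∂A.law

/-- The expected number of oracle queries on the input `f` (possibly infinite). -/
noncomputable def RandAlgorithm.expectedQueries {V : Type u} (A : RandAlgorithm.{u, v} V)
    (f : Finset V → ℝ) : ENNReal :=
  ∫⁻ ω, ((A.alg ω).numQueries f : ENNReal) ∂A.law

/-- `A` has approximation ratio `α` on the ground set `V`: for every non-negative symmetric
submodular `f`, its output is almost surely feasible, and the expected value of the output is at
least `α` times the value of every feasible set, hence at least `α` times the optimum. -/
def RandAlgorithm.HasApproxRatio {V : Type u} [Fintype V] [DecidableEq V]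
    (A : RandAlgorithm.{u, v} V) (C : Constraint) (p q : ℕ) (α : ℝ) : Prop :=
  ∀ f : Finset V → ℝ, IsObjective f →
    (∀ᵐ ω ∂A.law, C.Feasible p q ((A.alg ω).result f)) ∧
    ∀ T : Finset V, C.Feasible p q T → α * f T ≤ A.expectedValue f

end ValueOracle

open MeasureTheory

namespace ValueOracle

/-! Arrange the ground set as a grid with `q` rows and `K = n / q` columns. `balancedCut` depends
only on the weight that a set takes from the first and last rows, and never exceeds K²/2. A hidden
sign per column, σ, orients its two end cells, and `biasedCut` adds a reward f_σ - g over g =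
`balancedCut` once the signed weight leaves [-δ, δ], where δ = dK. The reward is convex with
curvature at most 1, so the concavity of g absorbs it and submodularity survives. Taking `p` cells
of each column, with the positive end and without the negative one, is feasible and has value close
to K².

For a fixed set and uniform σ, the signed weight is a Rademacher sum. By Chernoff, the set separates
f_σ from g for an exponentially small fraction of the σ (`card_biasedCut_ne_le`). Hence few queries
on g leave most f_σ indistinguishable from g, with output value at most K²/2
(`DetAlgorithm.card_result_gt_le`). Ratio 1/2 + ε, however, forces a value above K²/2 with
probability at least ε/4 for every σ (`le_measureReal_result_gt`). Averaging over σ makes the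
expected number of queries on g itself exponential. -/

/-! ### Convexity and curvature of the dead-zone function -/

/-- The projection of a real number to the interval `[-δ, δ]`. -/
noncomputable def clamp (δ x : ℝ) : ℝ := max (-δ) (min x δ)

/-- Half of the squared distance of a real number to the interval `[-δ, δ]`. -/
noncomputable def deadZone (δ x : ℝ) : ℝ := (x - clamp δ x) ^ 2 / 2

lemma clamp_mono (δ : ℝ) : Monotone (clamp δ) := fun _ _ h =>
  max_le_max le_rfl (min_le_min h le_rfl)

lemma clamp_cases {δ : ℝ} (hδ : 0 ≤ δ) (x : ℝ) :
    (x ≤ -δ ∧ clamp δ x = -δ) ∨ (-δ ≤ x ∧ x ≤ δ ∧ clamp δ x = x) ∨ (δ ≤ x ∧ clamp δ x = δ) := by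
  unfold clamp
  rcases le_total x (-δ) with h | h
  · left; exact ⟨h, by rw [min_eq_left (by linarith), max_eq_left h]⟩
  rcases le_total x δ with h' | h'
  · right; left; exact ⟨h, h', by rw [min_eq_left h', max_eq_right h]⟩
  · right; right; exact ⟨h', by rw [min_eq_right h', max_eq_right (by linarith)]⟩

lemma deadZone_nonneg (δ x : ℝ) : 0 ≤ deadZone δ x := by unfold deadZone; positivity

lemma deadZone_neg {δ : ℝ} (hδ : 0 ≤ δ) (x : ℝ) : deadZone δ (-x) = deadZone δ x := by
  unfold deadZone
  rcases clamp_cases hδ x with h | h | h <;> rcases clamp_cases hδ (-x) with h' | h' | h' <;>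
    simp only [h, h'] <;> nlinarith

lemma deadZone_eq_zero {δ x : ℝ} (h : |x| ≤ δ) : deadZone δ x = 0 := by
  obtain ⟨h₁, h₂⟩ := abs_le.1 h
  simp [deadZone, clamp, min_eq_left h₂, max_eq_right h₁]

lemma deadZone_of_le {δ x : ℝ} (hδ : 0 ≤ δ) (h : δ ≤ x) : deadZone δ x = (x - δ) ^ 2 / 2 := by
  rw [deadZone, clamp, min_eq_right h, max_eq_right (by linarith)]

lemma deadZone_le {δ : ℝ} (hδ : 0 ≤ δ) (x : ℝ) : deadZone δ x ≤ x ^ 2 / 2 := by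
  unfold deadZone
  rcases clamp_cases hδ x with h | h | h <;> simp only [h] <;> nlinarith

/-- A function with a monotone choice of subgradients has increasing differences. -/
lemma add_le_add_of_subgradient {ψ s : ℝ → ℝ} (hs : Monotone s)
    (h : ∀ y z, ψ y + s y * (z - y) ≤ ψ z) {x a b : ℝ} (ha : 0 ≤ a) (hb : 0 ≤ b) :
    ψ (x + a) + ψ (x + b) ≤ ψ x + ψ (x + a + b) := by
  wlog hab : a ≤ b generalizing a b
  · have := this hb ha (le_of_not_ge hab)
    rw [add_right_comm x b a] at this
    linarith
  -- ψ(x+a) - ψ(x) ≤ a s(x+a) ≤ a s(x+b) ≤ ψ(x+a+b) - ψ(x+b).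
  have h₁ := h (x + a) x
  have h₂ := h (x + b) (x + a + b)
  have h₃ : s (x + a) ≤ s (x + b) := hs (by linarith)
  nlinarith [mul_le_mul_of_nonneg_right h₃ ha]

lemma deadZone_increasing_differences {δ : ℝ} (hδ : 0 ≤ δ) {x a b : ℝ} (ha : 0 ≤ a)
    (hb : 0 ≤ b) :
    deadZone δ (x + a) + deadZone δ (x + b) ≤ deadZone δ x + deadZone δ (x + a + b) := by
  refine add_le_add_of_subgradient (s := fun y => y - clamp δ y) (fun y z hyz => ?_)
    (fun y z => ?_) ha hb
  · rcases clamp_cases hδ y with h | h | h <;> rcases clamp_cases hδ z with h' | h' | h' <;>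
      simp only [h, h'] <;> linarith
  · unfold deadZone
    rcases clamp_cases hδ y with h | h | h <;> rcases clamp_cases hδ z with h' | h' | h' <;>
      simp only [h, h'] <;> nlinarith [sq_nonneg (y - z)]

/-- Curvature at most 1: y²/2 minus the dead-zone function is still convex, with derivative `clamp
δ`. -/
lemma deadZone_differences_le_mul {δ : ℝ} (hδ : 0 ≤ δ) {x a b : ℝ} (ha : 0 ≤ a)
    (hb : 0 ≤ b) :
    deadZone δ x + deadZone δ (x + a + b) ≤ deadZone δ (x + a) + deadZone δ (x + b) + a * b := by
  have := add_le_add_of_subgradient (ψ := fun y => y ^ 2 / 2 - deadZone δ y) (s := clamp δ)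
    (clamp_mono δ) (x := x) (fun y z => ?_) ha hb
  · nlinarith
  · simp only [deadZone]
    rcases clamp_cases hδ y with h | h | h <;> rcases clamp_cases hδ z with h' | h' | h' <;>
      simp only [h, h'] <;> nlinarith [sq_nonneg (y - z)]

/-- Increments of equal sign use the curvature bound; for opposite signs, convexity already makes
the mixed difference nonpositive. -/
lemma deadZone_differences_le_abs_mul {δ : ℝ} (hδ : 0 ≤ δ) (x a b : ℝ) :
    deadZone δ (x + a + b) + deadZone δ x
      ≤ deadZone δ (x + a) + deadZone δ (x + b) + |a| * |b| := by
  have key : 0 ≤ |a| * |b| := by positivity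
  rcases le_total 0 a with ha | ha <;> rcases le_total 0 b with hb | hb
  · rw [abs_of_nonneg ha, abs_of_nonneg hb]
    linarith [deadZone_differences_le_mul hδ (x := x) ha hb]
  · have := deadZone_increasing_differences hδ (x := x + b) ha (neg_nonneg.2 hb)
    rw [show x + b + a = x + a + b by ring, show x + b + -b = x by ring,
      show x + a + b + -b = x + a by ring] at this
    linarith
  · have := deadZone_increasing_differences hδ (x := x + a) (neg_nonneg.2 ha) hb
    rw [show x + a + -a + b = x + b by ring, show x + a + -a = x by ring] at this
    linarith
  · have := deadZone_differences_le_mul hδ (x := x + a + b) (neg_nonneg.2 ha) (neg_nonneg.2 hb)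
    rw [show x + a + b + -a + -b = x by ring, show x + a + b + -a = x + b by ring,
      show x + a + b + -b = x + a by ring] at this
    rw [abs_of_nonpos ha, abs_of_nonpos hb]
    linarith

/-! ### The submodular objectives -/

section Objective

variable {V : Type u}

/-- The concave function `K s - s ^ 2 / 2` of the `u`-weight `s` of a set. -/
noncomputable def balancedCut (K : ℝ) (u : V → ℝ) (S : Finset V) : ℝ :=
  K * (∑ v ∈ S, u v) - (∑ v ∈ S, u v) ^ 2 / 2

/-- `balancedCut` plus a reward for sets whose signed weight leaves `[-δ, δ]`. For `δ = 0` and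
`u = |w| = 1`, this is the cut function of a complete bipartite graph with sides `w = 1` and
`w = -1`. -/
noncomputable def biasedCut (K δ : ℝ) (u w : V → ℝ) (S : Finset V) : ℝ :=
  balancedCut K u S + deadZone δ (∑ v ∈ S, w v)

lemma balancedCut_le (K : ℝ) (u : V → ℝ) (S : Finset V) : balancedCut K u S ≤ K ^ 2 / 2 := by
  unfold balancedCut
  nlinarith [sq_nonneg (K - ∑ v ∈ S, u v)]

lemma biasedCut_zero {δ : ℝ} (hδ : 0 ≤ δ) (K : ℝ) (u : V → ℝ) :
    biasedCut K δ u 0 = balancedCut K u := by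
  ext S
  simp [biasedCut, deadZone_eq_zero (x := 0) (by simpa using hδ)]

variable [Fintype V] [DecidableEq V] {K δ : ℝ} {u w : V → ℝ}

/-- The submodularity slack of the quadratic part is exactly u(S \ T) u(T \ S), which dominates |w(S
\ T)| |w(T \ S)|, the most that the reward can lose. -/
lemma isObjective_biasedCut (hδ : 0 ≤ δ) (hw : ∀ v, |w v| ≤ u v)
    (hu : ∑ v, u v = 2 * K) (hw₀ : ∑ v, w v = 0) : IsObjective (biasedCut K δ u w) where
  nonneg S := by
    have hu₀ : ∀ v, 0 ≤ u v := fun v => (abs_nonneg _).trans (hw v)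
    have h₁ : 0 ≤ ∑ v ∈ S, u v := Finset.sum_nonneg fun v _ => hu₀ v
    have h₂ : ∑ v ∈ S, u v ≤ 2 * K :=
      hu ▸ Finset.sum_le_sum_of_subset_of_nonneg (Finset.subset_univ S) fun v _ _ => hu₀ v
    have := deadZone_nonneg δ (∑ v ∈ S, w v)
    unfold biasedCut balancedCut
    nlinarith
  symmetric S := by
    have h₁ : ∑ v ∈ Sᶜ, u v = 2 * K - ∑ v ∈ S, u v := by
      rw [← hu, ← Finset.sum_add_sum_compl S u]; ring
    have h₂ : ∑ v ∈ Sᶜ, w v = -∑ v ∈ S, w v := by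
      have := Finset.sum_add_sum_compl S w
      linarith
    unfold biasedCut balancedCut
    rw [h₁, h₂, deadZone_neg hδ]
    ring
  submodular S T := by
    have split (x : V → ℝ) :
        ∑ v ∈ S, x v = ∑ v ∈ S ∩ T, x v + ∑ v ∈ S \ T, x v ∧
        ∑ v ∈ T, x v = ∑ v ∈ S ∩ T, x v + ∑ v ∈ T \ S, x v ∧
        ∑ v ∈ S ∪ T, x v = ∑ v ∈ S ∩ T, x v + ∑ v ∈ S \ T, x v + ∑ v ∈ T \ S, x v := by
      have h₁ := Finset.sum_inter_add_sum_sdiff S T x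
      have h₂ := Finset.sum_inter_add_sum_sdiff T S x
      have h₃ := Finset.sum_union_inter (s₁ := S) (s₂ := T) (f := x)
      rw [Finset.inter_comm T S] at h₂
      refine ⟨?_, ?_, ?_⟩ <;> linarith
    have le (R : Finset V) : |∑ v ∈ R, w v| ≤ ∑ v ∈ R, u v :=
      (Finset.abs_sum_le_sum_abs _ _).trans (Finset.sum_le_sum fun v _ => hw v)
    obtain ⟨u₁, u₂, u₃⟩ := split u
    obtain ⟨w₁, w₂, w₃⟩ := split w
    have h := deadZone_differences_le_abs_mul hδ (∑ v ∈ S ∩ T, w v) (∑ v ∈ S \ T, w v)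
      (∑ v ∈ T \ S, w v)
    have h' := mul_le_mul (le (S \ T)) (le (T \ S)) (abs_nonneg _)
      ((abs_nonneg _).trans (le (S \ T)))
    unfold biasedCut balancedCut
    rw [u₁, u₂, u₃, w₁, w₂, w₃]
    nlinarith

lemma isObjective_balancedCut (hu₀ : ∀ v, 0 ≤ u v) (hu : ∑ v, u v = 2 * K) :
    IsObjective (balancedCut K u) := by
  rw [← biasedCut_zero le_rfl]
  exact isObjective_biasedCut le_rfl (by simpa using hu₀) hu (by simp)

lemma biasedCut_le (hδ : 0 ≤ δ) (hw : ∀ v, |w v| ≤ u v) (hu : ∑ v, u v = 2 * K)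
    (hw₀ : ∑ v, w v = 0) (S : Finset V) : biasedCut K δ u w S ≤ K ^ 2 := by
  have le (R : Finset V) : |∑ v ∈ R, w v| ≤ ∑ v ∈ R, u v :=
    (Finset.abs_sum_le_sum_abs _ _).trans (Finset.sum_le_sum fun v _ => hw v)
  have h₁ := Finset.sum_add_sum_compl S u
  have h₂ := Finset.sum_add_sum_compl S w
  have h₃ := abs_le.1 (le S)
  have h₄ := abs_le.1 (le Sᶜ)
  have h₅ := deadZone_le hδ (∑ v ∈ S, w v)
  -- Both S and its complement bound |w(S)|. With r = |K - u(S)|, the total is then at most (K² -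
  -- r²)/2 + (K - r)²/2 = K² - Kr.
  have h₆ : |∑ v ∈ S, w v| ≤ K - |K - (∑ v ∈ S, u v)| := by
    rw [abs_le]
    rcases abs_cases (K - (∑ v ∈ S, u v)) with h | h <;> rw [h.1] <;> constructor <;> linarith
  unfold biasedCut balancedCut
  have hK : |K - (∑ v ∈ S, u v)| ≤ K := by
    rw [abs_le]
    constructor <;> linarith
  have h₇ := pow_le_pow_left₀ (abs_nonneg _) h₆ 2
  rw [sq_abs] at h₇
  have h₈ := sq_abs (K - ∑ v ∈ S, u v)
  nlinarith [abs_nonneg (K - ∑ v ∈ S, u v)]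

end Objective

/-! ### Chernoff bounds, stated as counts of sign patterns -/

section Rademacher

/-- The sign encoded by a Boolean. -/
def boolSign (b : Bool) : ℝ := if b then 1 else -1

lemma abs_boolSign (b : Bool) : |boolSign b| = 1 := by cases b <;> simp [boolSign]

variable {ι : Type*} [Fintype ι] [DecidableEq ι]

lemma sum_exp_rademacher_le (c : ι → ℝ) (hc : ∀ i, |c i| ≤ 1) (l : ℝ) :
    ∑ σ : ι → Bool, Real.exp (l * ∑ i, boolSign (σ i) * c i)
      ≤ 2 ^ Fintype.card ι * Real.exp (l ^ 2 * Fintype.card ι / 2) := by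
  have h₁ : ∑ σ : ι → Bool, Real.exp (l * ∑ i, boolSign (σ i) * c i)
      = ∏ i, ∑ b : Bool, Real.exp (l * (boolSign b * c i)) := by
    rw [Finset.prod_univ_sum, Fintype.piFinset_univ]
    exact Finset.sum_congr rfl fun σ _ => by rw [Finset.mul_sum, Real.exp_sum]
  have h₂ (i : ι) : ∑ b : Bool, Real.exp (l * (boolSign b * c i)) ≤ 2 * Real.exp (l ^ 2 / 2) := by
    have h := Real.cosh_le_exp_half_sq (l * c i)
    have h' : (l * c i) ^ 2 / 2 ≤ l ^ 2 / 2 := by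
      have : c i ^ 2 ≤ 1 := (sq_le_one_iff_abs_le_one _).2 (hc i)
      nlinarith [sq_nonneg l]
    have h'' := h.trans (Real.exp_le_exp.2 h')
    rw [Real.cosh_eq] at h''
    simp only [Fintype.sum_bool, boolSign, if_true, Bool.false_eq_true, if_false, one_mul,
      neg_mul, mul_neg]
    linarith
  rw [h₁]
  refine (Finset.prod_le_prod (fun i _ => Finset.sum_nonneg fun b _ => (Real.exp_pos _).le)
    fun i _ => h₂ i).trans_eq ?_
  rw [Finset.prod_const, Finset.card_univ, mul_pow, ← Real.exp_nat_mul]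
  congr 2
  ring

/-- The Chernoff bound for Rademacher sums, upper tail. -/
lemma card_rademacher_gt_le (c : ι → ℝ) (hc : ∀ i, |c i| ≤ 1) (l a : ℝ) (hl : 0 ≤ l) :
    ((Finset.univ.filter fun σ : ι → Bool => a < ∑ i, boolSign (σ i) * c i).card : ℝ)
      ≤ 2 ^ Fintype.card ι * Real.exp (l ^ 2 * Fintype.card ι / 2 - l * a) := by
  have h₁ := Finset.card_nsmul_le_sum
    (Finset.univ.filter fun σ : ι → Bool => a < ∑ i, boolSign (σ i) * c i)
    (fun σ => Real.exp (l * ∑ i, boolSign (σ i) * c i)) (Real.exp (l * a))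
    fun σ hσ => Real.exp_le_exp.2 (mul_le_mul_of_nonneg_left (Finset.mem_filter.1 hσ).2.le hl)
  have h₂ := Finset.sum_le_sum_of_subset_of_nonneg
    (Finset.filter_subset (fun σ : ι → Bool => a < ∑ i, boolSign (σ i) * c i) Finset.univ)
    (f := fun σ => Real.exp (l * ∑ i, boolSign (σ i) * c i)) fun _ _ _ => (Real.exp_pos _).le
  rw [Real.exp_sub, ← mul_div_assoc, le_div_iff₀ (Real.exp_pos _), ← nsmul_eq_mul]
  exact h₁.trans (h₂.trans (sum_exp_rademacher_le c hc l))

/-- The Chernoff bound for Rademacher sums, both tails. -/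
lemma card_rademacher_abs_gt_le (c : ι → ℝ) (hc : ∀ i, |c i| ≤ 1) (d : ℝ) (hd : 0 ≤ d) :
    ((Finset.univ.filter fun σ : ι → Bool =>
        d * Fintype.card ι < |∑ i, boolSign (σ i) * c i|).card : ℝ)
      ≤ 2 * (2 ^ Fintype.card ι * Real.exp (-(d ^ 2 * Fintype.card ι / 2))) := by
  have h₁ := card_rademacher_gt_le c hc d (d * Fintype.card ι) hd
  have h₂ := card_rademacher_gt_le (fun i => -c i) (by simpa using hc) d (d * Fintype.card ι) hd
  have h₃ : (Finset.univ.filter fun σ : ι → Bool =>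
      d * Fintype.card ι < |∑ i, boolSign (σ i) * c i|) ⊆
      (Finset.univ.filter fun σ : ι → Bool => d * Fintype.card ι < ∑ i, boolSign (σ i) * c i) ∪
      (Finset.univ.filter fun σ : ι → Bool =>
        d * Fintype.card ι < ∑ i, boolSign (σ i) * -c i) := by
    intro σ
    simp [lt_abs]
  have h₄ := (Finset.card_le_card h₃).trans (Finset.card_union_le _ _)
  have h₅ : d ^ 2 * (Fintype.card ι : ℝ) / 2 - d * (d * Fintype.card ι)
      = -(d ^ 2 * Fintype.card ι / 2) := by ring
  rw [h₅] at h₁ h₂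
  have h₆ := (Nat.cast_le (α := ℝ)).2 h₄
  push_cast at h₆
  linarith

end Rademacher

/-! ### Query counts and indistinguishable objectives -/

section Indistinguishability

variable {V : Type u} {ι : Type*} [Fintype ι]

/-- If every set distinguishes at most `κ` of the functions `f i` from `g ≤ m`, then a
deterministic algorithm that makes `t` queries on `g` finds a value above `m` for at most
`(t + 1) κ` of them. -/
lemma DetAlgorithm.card_result_gt_le (f : ι → Finset V → ℝ) (g : Finset V → ℝ) {m : ℝ}
    (hg : ∀ S, g S ≤ m) {κ : ℝ} (hκ : ∀ S, ({i | f i S ≠ g S}.ncard : ℝ) ≤ κ)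
    (d : DetAlgorithm V) :
    ({i | m < f i (d.result (f i))}.ncard : ℝ) ≤ (d.numQueries g + 1) * κ := by
  induction d with
  -- The output set counts as one more query, hence the `+ 1`: its value can exceed `m` only if it
  -- separates `f i` from `g`.
  | output S =>
    simp only [DetAlgorithm.result, DetAlgorithm.numQueries, Nat.cast_zero, zero_add, one_mul]
    have hsub : {i | m < f i S} ⊆ {i | f i S ≠ g S} := by
      intro i (h : m < f i S) h'
      exact absurd (hg S) (by rw [← h']; exact not_le.2 h)
    exact (Nat.cast_le.2 (Set.ncard_le_ncard hsub)).trans (hκ S)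
  | query S next ih =>
    simp only [DetAlgorithm.result, DetAlgorithm.numQueries]
    -- Only the branch answered by `g` is followed; every `i` leaving it is charged to `S`.
    have hsub : {i | m < f i ((next (f i S)).result (f i))} ⊆
        {i | f i S ≠ g S} ∪ {i | m < f i ((next (g S)).result (f i))} := by
      intro i (h : m < _)
      by_cases h' : f i S = g S
      · exact Or.inr (h' ▸ h)
      · exact Or.inl h'
    have h₁ := (Nat.cast_le (α := ℝ)).2 ((Set.ncard_le_ncard hsub).trans (Set.ncard_union_le _ _))
    have h₂ := ih (g S)
    have h₃ := hκ S
    push_cast at h₁ ⊢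
    linarith

variable (A : RandAlgorithm.{u, v} V)

lemma RandAlgorithm.measurable_comp_result [Fintype V] (f : Finset V → ℝ) :
    Measurable fun ω => f ((A.alg ω).result f) := by
  classical
  let _ : MeasurableSpace (Finset V) := ⊤
  have h : Measurable fun ω => (A.alg ω).result f :=
    measurable_to_countable' fun S => A.measurableSet_result f S
  exact (measurable_from_top (f := f)).comp h

lemma RandAlgorithm.measurable_numQueries (f : Finset V → ℝ) :
    Measurable fun ω => (A.alg ω).numQueries f :=
  measurable_to_countable' fun k => A.measurableSet_numQueries f k

lemma RandAlgorithm.sum_measure_result_gt_le [Fintype V] (f : ι → Finset V → ℝ) (g : Finset V → ℝ) {m : ℝ}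
    (hg : ∀ S, g S ≤ m) {κ : ℝ} (hκ : ∀ S, ({i | f i S ≠ g S}.ncard : ℝ) ≤ κ) :
    ∑ i, A.law {ω | m < f i ((A.alg ω).result (f i))}
      ≤ (A.expectedQueries g + 1) * ENNReal.ofReal κ := by
  classical
  have hmeas (i : ι) : MeasurableSet {ω | m < f i ((A.alg ω).result (f i))} :=
    measurableSet_lt measurable_const (A.measurable_comp_result (f i))
  have hnum : Measurable fun ω => ((A.alg ω).numQueries g : ENNReal) :=
    (measurable_of_countable (fun k : ℕ => (k : ENNReal))).comp (A.measurable_numQueries g)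
  calc ∑ i, A.law {ω | m < f i ((A.alg ω).result (f i))}
      = ∫⁻ ω, ∑ i, {ω | m < f i ((A.alg ω).result (f i))}.indicator 1 ω ∂A.law := by
        rw [lintegral_finsetSum _ fun i _ => measurable_one.indicator (hmeas i)]
        exact Finset.sum_congr rfl fun i _ => (lintegral_indicator_one (hmeas i)).symm
    _ ≤ ∫⁻ ω, (((A.alg ω).numQueries g : ENNReal) + 1) * ENNReal.ofReal κ ∂A.law := by
        refine lintegral_mono fun ω => ?_
        have h := (A.alg ω).card_result_gt_le f g hg hκ
        have h' := ENNReal.ofReal_le_ofReal h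
        rw [ENNReal.ofReal_mul (by positivity), ENNReal.ofReal_natCast,
          ENNReal.ofReal_add (by positivity) zero_le_one, ENNReal.ofReal_natCast,
          ENNReal.ofReal_one] at h'
        refine le_trans (le_of_eq ?_) h'
        simp [Set.indicator_apply, Finset.sum_boole, Set.ncard_eq_toFinset_card']
    _ = (A.expectedQueries g + 1) * ENNReal.ofReal κ := by
        rw [lintegral_mul_const _ (hnum.add_const 1), lintegral_add_left hnum]
        simp [expectedQueries]

lemma RandAlgorithm.expectedValue_le [Fintype V] {f : Finset V → ℝ} {m M : ℝ} (hm : 0 ≤ m)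
    (hf₀ : ∀ S, 0 ≤ f S) (hf : ∀ S, f S ≤ M) :
    A.expectedValue f ≤ m + M * A.law.real {ω | m < f ((A.alg ω).result f)} := by
  have hmeas : MeasurableSet {ω | m < f ((A.alg ω).result f)} :=
    measurableSet_lt measurable_const (A.measurable_comp_result f)
  have hint : Integrable ({ω | m < f ((A.alg ω).result f)}.indicator fun _ => M) A.law :=
    (integrable_const M).indicator hmeas
  calc A.expectedValue f
      ≤ ∫ ω, (m + {ω | m < f ((A.alg ω).result f)}.indicator (fun _ => M) ω) ∂A.law := by
        refine integral_mono_of_nonneg (ae_of_all _ fun ω => hf₀ _)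
          ((integrable_const m).add hint) (ae_of_all _ fun ω => ?_)
        by_cases h : m < f ((A.alg ω).result f)
        · simpa [Set.indicator_apply, h] using (hf _).trans (le_add_of_nonneg_left hm)
        · simpa [Set.indicator_apply, h] using not_lt.1 h
    _ = m + M * A.law.real {ω | m < f ((A.alg ω).result f)} := by
        rw [integral_add (integrable_const m) hint, integral_indicator_const _ hmeas]
        simp [mul_comm]

end Indistinguishability

/-! ### The signed grid -/

section Grid

variable {q K : ℕ}

/-- The signed weights of the rows of a grid with `q` rows: `1` on the first row, `-1` on the last
row, and `0` elsewhere. -/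
def rowSign (q : ℕ) (i : Fin q) : ℝ :=
  if (i : ℕ) = 0 then 1 else if (i : ℕ) + 1 = q then -1 else 0

lemma sum_rowSign_mem_filter {s : ℕ} (hs : 0 < s) (hsq : s < q) :
    ∑ i ∈ Finset.univ.filter fun i : Fin q => (i : ℕ) < s, rowSign q i = 1 := by
  rw [Finset.sum_eq_single_of_mem (⟨0, by omega⟩ : Fin q) (by simpa using hs)]
  · simp [rowSign]
  · intro i hi h
    have h₁ : (i : ℕ) ≠ 0 := fun h' => h (Fin.ext h')
    have h₂ : (i : ℕ) < s := by simpa using hi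
    rw [rowSign, if_neg h₁, if_neg (by omega)]

lemma sum_abs_rowSign_mem_filter {s : ℕ} (hs : 0 < s) (hsq : s < q) :
    ∑ i ∈ Finset.univ.filter fun i : Fin q => (i : ℕ) < s, |rowSign q i| = 1 := by
  rw [← sum_rowSign_mem_filter hs hsq]
  refine Finset.sum_congr rfl fun i hi => ?_
  have h₂ : (i : ℕ) < s := by simpa using hi
  rw [abs_of_nonneg]
  unfold rowSign
  split_ifs <;> first | omega | norm_num

lemma sum_comp_rowSign (hq : 1 < q) (φ : ℝ → ℝ) (h₀ : φ 0 = 0) :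
    ∑ i, φ (rowSign q i) = φ 1 + φ (-1) := by
  obtain ⟨r, rfl⟩ : ∃ r, q = r + 2 := ⟨q - 2, by omega⟩
  rw [Fin.sum_univ_castSucc, Fin.sum_univ_succ, Finset.sum_eq_zero]
  · simp [rowSign]
  · intro i _
    have := i.isLt
    simp [rowSign, h₀, this.ne]

/-- The exchange of the first and the last row. -/
def rowSwap (hq : 0 < q) : Equiv.Perm (Fin q) := Equiv.swap ⟨0, hq⟩ ⟨q - 1, by omega⟩

lemma rowSign_rowSwap (hq : 1 < q) (i : Fin q) :
    rowSign q (rowSwap (by omega) i) = -rowSign q i := by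
  unfold rowSwap
  rw [Equiv.swap_apply_def]
  split_ifs with h₁ h₂
  · subst h₁
    simp [rowSign, show q - 1 ≠ 0 by omega, show q - 1 + 1 = q by omega]
  · subst h₂
    simp [rowSign, show q - 1 ≠ 0 by omega, show q - 1 + 1 = q by omega]
  · have h₃ : (i : ℕ) ≠ 0 := fun h => h₁ (Fin.ext h)
    have h₄ : (i : ℕ) + 1 ≠ q := fun h => h₂ (Fin.ext (by simp; omega))
    simp [rowSign, h₃, h₄]

/-- The signed weights of the cells of a grid, where the columns `j` with `σ j = false` have their
signs changed. -/
def cellSign (σ : Fin K → Bool) (x : Fin q × Fin K) : ℝ := boolSign (σ x.2) * rowSign q x.1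

/-- The permutation of the cells of a grid that exchanges the ends of the columns `j` with
`σ j = false`. -/
def columnSwap (hq : 0 < q) (σ : Fin K → Bool) : Equiv.Perm (Fin q × Fin K) :=
  Equiv.prodCongrLeft fun j => if σ j then Equiv.refl _ else rowSwap hq

lemma cellSign_eq (hq : 1 < q) (σ : Fin K → Bool) (x : Fin q × Fin K) :
    cellSign σ x = rowSign q (columnSwap (by omega) σ x).1 := by
  obtain ⟨i, j⟩ := x
  cases h : σ j <;> simp [cellSign, columnSwap, boolSign, h, rowSign_rowSwap hq]

/-- Straightening the columns by `columnSwap` turns every sign pattern into the unswapped one, so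
such sums do not depend on σ. -/
lemma sum_cellSign_columnSwap (hq : 1 < q) (φ : ℝ → ℝ) (P : Fin q → Prop) [DecidablePred P]
    (σ : Fin K → Bool) :
    ∑ x : Fin q × Fin K with P (columnSwap (by omega) σ x).1, φ (cellSign σ x)
      = K * ∑ i with P i, φ (rowSign q i) := by
  simp only [Finset.sum_filter, cellSign_eq hq]
  rw [Equiv.sum_comp (columnSwap (by omega) σ)
    (fun x : Fin q × Fin K => if P x.1 then φ (rowSign q x.1) else 0), Fintype.sum_prod_type]
  simp [Finset.mul_sum]

lemma abs_cellSign (σ : Fin K → Bool) (x : Fin q × Fin K) : |cellSign σ x| = |rowSign q x.1| := by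
  rw [cellSign, abs_mul, abs_boolSign, one_mul]

end Grid

/-! ### The hard family and the lower bound -/

lemma card_biasedCut_ne_le {V : Type u} {q K : ℕ} (hq : 1 < q)
    (e : V ≃ Fin q × Fin K) {d : ℝ} (hd : 0 ≤ d) (k : ℝ) (u : V → ℝ) (S : Finset V) :
    ({σ : Fin K → Bool |
        biasedCut k (d * K) u (fun v => cellSign σ (e v)) S ≠ balancedCut k u S}.ncard : ℝ)
      ≤ 2 * (2 ^ K * Real.exp (-(d ^ 2 * K / 2))) := by
  classical
  set c : Fin K → ℝ := fun j => ∑ i, if e.symm (i, j) ∈ S then rowSign q i else 0 with hc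
  have hsum (σ : Fin K → Bool) : ∑ v ∈ S, cellSign σ (e v) = ∑ j, boolSign (σ j) * c j := by
    have h : ∑ v ∈ S, cellSign σ (e v)
        = ∑ x : Fin q × Fin K, if e.symm x ∈ S then cellSign σ x else 0 := by
      have : Fintype V := Fintype.ofEquiv _ e.symm
      rw [← Equiv.sum_comp e]
      simp
    rw [h, Fintype.sum_prod_type_right]
    refine Finset.sum_congr rfl fun j _ => ?_
    simp [hc, Finset.mul_sum, cellSign]
  have hc₁ (j : Fin K) : |c j| ≤ 1 := by
    -- A column has one entry 1 and one entry -1, so its partial sums lie in [-1, 1].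
    have hpos := sum_comp_rowSign hq (fun x => max x 0) (by simp)
    have hneg := sum_comp_rowSign hq (fun x => min x 0) (by simp)
    norm_num at hpos hneg
    rw [abs_le]
    constructor
    · rw [← hneg]
      refine Finset.sum_le_sum fun i _ => ?_
      split_ifs <;> simp
    · rw [← hpos]
      refine Finset.sum_le_sum fun i _ => ?_
      split_ifs <;> simp
  have h := card_rademacher_abs_gt_le c hc₁ d hd
  rw [Fintype.card_fin] at h
  refine le_trans ?_ h
  rw [Set.ncard_eq_toFinset_card', Set.toFinset_ofPred]
  refine Nat.cast_le.2 (Finset.card_le_card fun σ => ?_)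
  simp only [Finset.mem_filter, Finset.mem_univ, true_and]
  contrapose!
  intro hle
  rw [biasedCut, hsum, deadZone_eq_zero hle, add_zero]

lemma le_measureReal_result_gt {V : Type u} [Fintype V] [DecidableEq V] {p q K : ℕ}
    (hp : 0 < p) (hpq : p < q) (hK : 0 < K) (e : V ≃ Fin q × Fin K) {ε d : ℝ}
    (hd : 0 ≤ d) (hd₁ : d ≤ 1 / 2) (hdε : d ≤ ε / 2) {C : Constraint}
    {A : RandAlgorithm.{u, v} V} (hA : A.HasApproxRatio C p q (1 / 2 + ε)) (σ : Fin K → Bool)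
    {f : Finset V → ℝ}
    (hf : f = biasedCut K (d * K) (fun v => |rowSign q (e v).1|) fun v => cellSign σ (e v)) :
    ε / 4 ≤ A.law.real {ω | (K : ℝ) ^ 2 / 2 < f ((A.alg ω).result f)} := by
  have hq : 1 < q := by omega
  have hK₀ : (0 : ℝ) < K := Nat.cast_pos.2 hK
  have hδ : 0 ≤ d * K := by positivity
  have hw (v : V) : |cellSign σ (e v)| ≤ |rowSign q (e v).1| := (abs_cellSign _ _).le
  have hu : ∑ v, |rowSign q (e v).1| = 2 * K := by
    rw [Equiv.sum_comp e fun x => |rowSign q x.1|, Fintype.sum_prod_type]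
    have := sum_comp_rowSign hq (fun x => |x|) abs_zero
    simp [← Finset.mul_sum, this]
    ring
  have hw₀ : ∑ v, cellSign σ (e v) = 0 := by
    rw [Equiv.sum_comp e fun x => cellSign σ x]
    have := sum_cellSign_columnSwap hq id (fun _ => True) σ
    have h := sum_comp_rowSign hq id rfl
    simp only [Finset.filter_true, id] at this h
    rw [this, h]
    simp
  have hobj : IsObjective f := hf ▸ isObjective_biasedCut hδ hw hu hw₀
  have hle (S : Finset V) : f S ≤ (K : ℝ) ^ 2 := hf ▸ biasedCut_le hδ hw hu hw₀ S
  -- The first `p` rows after straightening: since 0 < p < q, they contain all positive ends and no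
  -- negative end.
  set T : Finset V :=
    Finset.univ.filter fun v => ((columnSwap (by omega) σ (e v)).1 : ℕ) < p with hT
  have hTsum (φ : Fin q × Fin K → ℝ) : ∑ v ∈ T, φ (e v)
      = ∑ x with ((columnSwap (by omega) σ x).1 : ℕ) < p, φ x := by
    rw [hT, Finset.sum_filter, Finset.sum_filter,
      Equiv.sum_comp e fun x => if ((columnSwap (by omega) σ x).1 : ℕ) < p then φ x else 0]
  have hTw : ∑ v ∈ T, cellSign σ (e v) = K := by
    have := sum_cellSign_columnSwap hq id (fun i => (i : ℕ) < p) σ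
    simp only [id] at this
    rw [hTsum, this]
    simp [sum_rowSign_mem_filter hp hpq]
  have hTu : ∑ v ∈ T, |rowSign q (e v).1| = K := by
    rw [Finset.sum_congr rfl fun v _ => (abs_cellSign σ (e v)).symm, hTsum fun x => |cellSign σ x|,
      sum_cellSign_columnSwap hq (fun x => |x|) (fun i => (i : ℕ) < p)]
    simp [sum_abs_rowSign_mem_filter hp hpq]
  have hTcard : (T.card : ℝ) = p * K := by
    have h₁ := hTsum fun _ => 1
    have h₂ := sum_cellSign_columnSwap hq (fun _ => 1) (fun i => (i : ℕ) < p) σ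
    rw [h₂] at h₁
    have h₃ : (Finset.univ.filter fun i : Fin q => (i : ℕ) < p).card = p := by
      rw [Fin.card_filter_val_lt, min_eq_right hpq.le]
    simp [h₃] at h₁
    rw [h₁, mul_comm]
  have hV : (Fintype.card V : ℝ) = q * K := by
    rw [Fintype.card_congr e]; simp
  have hfeas : C.Feasible p q T := by
    have h : (T.card : ℝ) = (p : ℝ) / (q : ℝ) * (Fintype.card V : ℝ) := by
      have : (q : ℝ) ≠ 0 := by positivity
      rw [hTcard, hV]
      field_simp
    cases C
    · exact h
    · exact h.le
  have hfT : f T = (K : ℝ) ^ 2 / 2 + (K - d * K) ^ 2 / 2 := by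
    rw [hf, biasedCut, balancedCut, hTw, hTu, deadZone_of_le hδ (by nlinarith)]
    ring
  have h₁ := (hA f hobj).2 T hfeas
  have h₂ := A.expectedValue_le (f := f) (m := (K : ℝ) ^ 2 / 2) (M := (K : ℝ) ^ 2)
    (by positivity) hobj.nonneg hle
  set P := A.law.real {ω | (K : ℝ) ^ 2 / 2 < f ((A.alg ω).result f)}
  have h₃ := h₁.trans h₂
  have h₄ : (1 / 2 + ε) * f T = (K : ℝ) ^ 2 * ((1 / 2 + ε) * (1 / 2 + (1 - d) ^ 2 / 2)) := by
    rw [hfT]; ring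
  have h₅ : (K : ℝ) ^ 2 / 2 + (K : ℝ) ^ 2 * P = (K : ℝ) ^ 2 * (1 / 2 + P) := by ring
  rw [h₄, h₅] at h₃
  have h₆ := le_of_mul_le_mul_left h₃ (by positivity)
  -- As (1 - d)² ≥ 1 - 2d, the left side is at least (1/2 + ε)(1 - d) ≥ 1/2 + ε/4, by d ≤ ε/2 and d
  -- ≤ 1/2.
  nlinarith [mul_nonneg (show 0 ≤ 1 / 2 + ε by linarith) (sq_nonneg d)]

end ValueOracle

open ValueOracle in
theorem theorem4 (p q : ℕ) (hp : 0 < p) (hpq : p < q) (ε : ℝ) (hε : 0 < ε) :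
    ∃ c : ℝ, 0 < c ∧ ∃ n₀ : ℕ,
      ∀ (V : Type u) [Fintype V] [DecidableEq V],
        n₀ ≤ Fintype.card V → q ∣ Fintype.card V →
        ∀ (C : ValueOracle.Constraint) (A : ValueOracle.RandAlgorithm.{u, v} V),
          A.HasApproxRatio C p q (1 / 2 + ε) →
          ∃ f : Finset V → ℝ, ValueOracle.IsObjective f ∧
            ENNReal.ofReal (Real.exp (c * (Fintype.card V : ℝ))) ≤ A.expectedQueries f := by
  obtain ⟨d, hd, hd₁, hdε⟩ : ∃ d : ℝ, 0 < d ∧ d ≤ 1 / 2 ∧ d ≤ ε / 2 :=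
    ⟨min (1 / 2) (ε / 2), by positivity, min_le_left _ _, min_le_right _ _⟩
  have hq : 1 < q := by omega
  have hq₀ : (0 : ℝ) < q := by positivity
  -- Half the Chernoff exponent per element, so that exp(cn)² cancels the tail exp(-d²K/2); the
  -- spare factor exp(cn) beats the constant 16/ε once n > 16/(εc).
  set c : ℝ := d ^ 2 / (4 * q) with hc
  have hc₀ : 0 < c := by positivity
  refine ⟨c, hc₀, ⌈16 / (ε * c)⌉₊ + 1, fun V _ _ hn hqn C A hA => ?_⟩
  obtain ⟨K, hK⟩ := hqn
  have hK₀ : 0 < K := Nat.pos_of_ne_zero fun h => by simp [h] at hK; omega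
  let e : V ≃ Fin q × Fin K := Fintype.equivOfCardEq (by simp [hK])
  set u : V → ℝ := fun v => |rowSign q (e v).1| with hu_def
  have hu : ∑ v, u v = 2 * K := by
    rw [hu_def, Equiv.sum_comp e fun x => |rowSign q x.1|, Fintype.sum_prod_type]
    have := sum_comp_rowSign hq (fun x => |x|) abs_zero
    simp [← Finset.mul_sum, this]
    ring
  refine ⟨balancedCut K u, isObjective_balancedCut (fun v => abs_nonneg _) hu, ?_⟩
  by_contra! hlt
  set E := Real.exp (c * (Fintype.card V : ℝ)) with hE
  set f : (Fin K → Bool) → Finset V → ℝ := fun σ =>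
    biasedCut K (d * K) u fun v => cellSign σ (e v) with hf
  have h₁ := A.sum_measure_result_gt_le f (balancedCut K u) (balancedCut_le K u)
    (card_biasedCut_ne_le hq e hd.le K u)
  have h₂ (σ : Fin K → Bool) : ENNReal.ofReal (ε / 4)
      ≤ A.law {ω | (K : ℝ) ^ 2 / 2 < f σ ((A.alg ω).result (f σ))} :=
    (ENNReal.ofReal_le_iff_le_toReal (measure_ne_top _ _)).2
      (le_measureReal_result_gt hp hpq hK₀ e hd.le hd₁ hdε hA σ rfl)
  have h₃ := (Finset.sum_le_sum fun σ (_ : σ ∈ Finset.univ) => h₂ σ).trans h₁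
  have hexp : Real.exp (-(d ^ 2 * K / 2)) * (E * E) = 1 := by
    rw [hE, ← Real.exp_add, ← Real.exp_add, Real.exp_eq_one_iff, hK, hc]
    push_cast
    field_simp
    ring
  have hE₁ : 1 + c * Fintype.card V ≤ E := by
    rw [hE, add_comm]; exact Real.add_one_le_exp _
  have hcard : 16 / (ε * c) < Fintype.card V :=
    lt_of_le_of_lt (Nat.le_ceil _) (by exact_mod_cast hn)
  have hE₂ : 16 < ε * E := by
    rw [div_lt_iff₀ (by positivity)] at hcard
    nlinarith
  have h₄ : A.expectedQueries (balancedCut K u) + 1 ≤ ENNReal.ofReal (E + 1) := by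
    rw [ENNReal.ofReal_add (Real.exp_pos _).le zero_le_one, ENNReal.ofReal_one]
    gcongr
  have h₅ := h₃.trans (mul_le_mul_left h₄ _)
  rw [← ENNReal.ofReal_mul (by positivity), Finset.sum_const, nsmul_eq_mul,
    ← ENNReal.ofReal_natCast, ← ENNReal.ofReal_mul (by positivity),
    ENNReal.ofReal_le_ofReal_iff (by positivity)] at h₅
  simp only [Finset.card_univ, Fintype.card_pi, Fintype.card_bool, Finset.prod_const,
    Fintype.card_fin, Nat.cast_pow, Nat.cast_ofNat] at h₅
  set x := Real.exp (-(d ^ 2 * K / 2)) with hx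
  have h₆ : (2 : ℝ) ^ K * (ε / 4) ≤ 2 ^ K * ((E + 1) * 2 * x) := by linarith
  have h₇ := le_of_mul_le_mul_left h₆ (by positivity)
  have hE₀ : 1 ≤ E := by nlinarith [mul_nonneg hc₀.le (Nat.cast_nonneg (α := ℝ) (Fintype.card V))]
  have hx₀ : 0 < x := Real.exp_pos _
  have h₈ : ε / 4 ≤ 4 * (E * x) := by nlinarith
  -- Multiplying by E and using E²x = 1 gives εE ≤ 16, against `hE₂`.
  nlinarith [mul_le_mul_of_nonneg_right h₈ (zero_le_one.trans hE₀)]
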